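/- Let $\mathbb{H}$ be the quaternions and let $QU=(\mathbb{H},S\mathbb{H})$, where $S\mathbb{H}=\{p\in\mathbb{H}:|p|=1\}$. Let $E$ be a finite set. A chain group over $\mathbb{H}$ on $E$ is a left $\mathbb{H}$-submodule $C\subseteq\mathbb{H}^E$; the support of $c\in C$ is $\|c\|=\{e\in E: c_e\neq 0\}$, and $c\in C$ is elementary if $c\neq 0$ and there is no nonzero $c'\in C$ with $\|c'\|\subsetneq\|c\|$. $C$ is a $QU$-chain group if every elementary $c\in C$ can be written as $c=rc'$ with $r\in\mathbb{H}$ and $c'\in C\cap(S\mathbb{H}\cup\{0\})^E$. In that case the supports of the elementary chains of $C$ are the cocircuits of a matroid $M(C)$ on $E$. Let $\phi:\mathbb{H}\to M(2,\mathbb{C})$ be the ring homomorphism $$\phi(a+bi+cj+dk)=\begin{bmatrix}a+bi&c+di\\-c+di&a-bi\end{bmatrix},$$ and for a square matrix $D$ over $\mathbb{H}$ put $\delta(D)=\sqrt{|\det z_2(\phi(D))|}$, where $z_2(\phi(D))$ is the complex matrix obtained by replacing each entry $D_{xy}$ with the $2\times 2$ block $\phi(D_{xy})$ (so $\delta$ of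 the empty matrix is $1$). Let $P_C=A^\dagger(AA^\dagger)^{-1}A$, where $A$ is any matrix over $\mathbb{H}$ whose rows are a basis of $C$ and $A^\dagger$ is its conjugate transpose; this $E\times E$ matrix does not depend on the choice of $A$. For $F\subseteq E$, let $P_C[F,F]$ be its submatrix with rows and columns indexed by $F$. **Theorem.** Let $C$ be a $QU$-chain group on $E$, and let $F\subseteq E$. Then $$\delta(P_C[F,F])=\frac{|\{B\subseteq E: B\text{ is a basis of }M(C)\text{ and }F\subseteq B\}|}{|\{B\subseteq E: B\text{ is a basis of }M(C)\}|}.$$ -/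

import Mathlib

open scoped Quaternion Matrix

/-! ### Skew partial fields and chain groups -/

/-- A skew partial field `(R, G)`: a subgroup `G` of the group of units of a ring `R`
(not necessarily commutative) such that `-1 ∈ G`. -/
structure SkewPartialField (R : Type*) [Ring R] where
  G : Subgroup Rˣ
  neg_one_mem : (-1 : Rˣ) ∈ G

section ChainGroups

variable {R : Type*} [Ring R] {E : Type*}

/-- A chain `c` of the `R`-chain group `C` (a left submodule of `R^E`) is elementary if it is
nonzero and no nonzero chain of `C` has strictly smaller support. -/
def IsElementaryChain (C : Submodule R (E → R)) (c : E → R) : Prop :=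
  c ∈ C ∧ c ≠ 0 ∧ ¬ ∃ c' ∈ C, c' ≠ 0 ∧ Function.support c' ⊂ Function.support c

/-- A chain is `G`-primitive if all its entries lie in `G ∪ {0}`. -/
def SkewPartialField.IsPrimitive (P : SkewPartialField R) (c : E → R) : Prop :=
  ∀ e, c e = 0 ∨ ∃ g ∈ P.G, c e = (g : R)

/-- An `R`-chain group `C` is a `P`-chain group, `P = (R, G)`, if every elementary chain of `C`
is a left multiple of a `G`-primitive chain of `C`. -/
def SkewPartialField.IsChainGroup (P : SkewPartialField R) (C : Submodule R (E → R)) : Prop :=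
  ∀ c, IsElementaryChain C c → ∃ c' ∈ C, P.IsPrimitive c' ∧ ∃ r : R, c = r • c'

/-! ### The matroid of a chain group -/

/-- The augmentation property, for the sets that contain no member of a family satisfying weak
circuit elimination. -/
theorem augment_of_elimination {E : Type*} [Finite E] (Circ : Set E → Prop)
    (elim : ∀ X Y, Circ X → Circ Y → X ≠ Y → ∀ e ∈ X ∩ Y, ∃ Z, Circ Z ∧ Z ⊆ (X ∪ Y) \ {e})
    {I J : Set E} (hI : ∀ X, Circ X → ¬ X ⊆ I) (hJ : ∀ X, Circ X → ¬ X ⊆ J)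
    (hIJ : I.ncard < J.ncard) :
    ∃ e ∈ J, e ∉ I ∧ ∀ X, Circ X → ¬ X ⊆ insert e I := by
  classical
  by_contra hcon
  have key : ∀ n, ∀ K : Set E, K ⊆ I ∪ J → (∀ X, Circ X → ¬ X ⊆ K) → I.ncard < K.ncard →
      (I \ K).ncard = n → False := by
    intro n
    induction n using Nat.strong_induction_on with
    | _ n ih =>
      intro K hKs hK hIK hn
      obtain ⟨g, hgK, hgI⟩ : ∃ g ∈ K, g ∉ I := Set.exists_mem_notMem_of_ncard_lt_ncard hIK
      have hne : (I \ K).Nonempty := by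
        by_contra hemp
        have hsub : I ⊆ K := Set.sdiff_eq_empty.1 (Set.not_nonempty_iff_eq_empty.1 hemp)
        refine hcon ⟨g, (hKs hgK).resolve_left hgI, hgI, fun X hX hXs => hK X hX (hXs.trans ?_)⟩
        exact Set.insert_subset hgK hsub
      obtain ⟨e, heI, heK⟩ := hne
      have hT : ∀ f ∈ K, f ∉ I → ∃ X, Circ X ∧ X ⊆ insert e K \ {f} := by
        intro f hfK hfI
        by_contra hno
        push Not at hno
        have hlt : (I \ (insert e K \ {f})).ncard < n := by
          rw [← hn]
          refine Set.ncard_lt_ncard ⟨?_, ?_⟩ (Set.toFinite _)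
          · rintro x ⟨hxI, hx⟩
            refine ⟨hxI, fun hxK => hx ⟨Set.mem_insert_of_mem _ hxK, ?_⟩⟩
            rintro rfl
            exact hfI hxI
          · intro hs
            refine (hs ⟨heI, heK⟩).2 ⟨Set.mem_insert _ _, ?_⟩
            rintro rfl
            exact heK hfK
        refine ih _ hlt (insert e K \ {f}) ?_ hno ?_ rfl
        · rintro x ⟨rfl | hx, -⟩
          · exact Or.inl heI
          · exact hKs hx
        · rw [Set.ncard_sdiff_singleton_of_mem (Set.mem_insert_of_mem _ hfK),
            Set.ncard_insert_of_notMem heK]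
          simpa using hIK
      have hTe : ∀ f X, Circ X → X ⊆ insert e K \ {f} → e ∈ X := by
        intro f X hX hXs
        by_contra heX
        refine hK X hX fun x hx => ?_
        rcases (hXs hx).1 with rfl | h
        · exact absurd hx heX
        · exact h
      obtain ⟨X, hX, hXs⟩ := hT g hgK hgI
      obtain ⟨h, hhX, hhI⟩ : ∃ h ∈ X, h ∉ I := by
        by_contra hno
        push Not at hno
        exact hI X hX hno
      have hhK : h ∈ K := by
        rcases (hXs hhX).1 with rfl | h'
        · exact absurd heI hhI
        · exact h'
      obtain ⟨Y, hY, hYs⟩ := hT h hhK hhI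
      have hXY : X ≠ Y := by
        rintro rfl
        exact (hYs hhX).2 rfl
      obtain ⟨Z, hZ, hZs⟩ := elim X Y hX hY hXY e ⟨hTe _ _ hX hXs, hTe _ _ hY hYs⟩
      refine hK Z hZ fun x hx => ?_
      have hxe : x ≠ e := (hZs hx).2
      rcases (hZs hx).1 with h' | h'
      · exact ((hXs h').1).resolve_left hxe
      · exact ((hYs h').1).resolve_left hxe
  exact key _ J Set.subset_union_right hJ hIJ rfl

theorem exists_isElementaryChain_support_subset [Finite E] (C : Submodule R (E → R))
    {d : E → R} (hd : d ∈ C) (hd0 : d ≠ 0) :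
    ∃ c, IsElementaryChain C c ∧ Function.support c ⊆ Function.support d := by
  classical
  obtain ⟨X, hXd, hX⟩ := (Set.toFinite
      {X : Set E | ∃ c ∈ C, c ≠ 0 ∧ Function.support c = X}).exists_le_minimal
      (a := Function.support d) ⟨d, hd, hd0, rfl⟩
  obtain ⟨c, hc, hc0, rfl⟩ := hX.prop
  refine ⟨c, ⟨hc, hc0, ?_⟩, hXd⟩
  rintro ⟨c', hc', hc'0, hlt⟩
  exact hlt.2 (hX.le_of_le ⟨c', hc', hc'0, rfl⟩ hlt.1)

theorem SkewPartialField.IsChainGroup.exists_primitive {P : SkewPartialField R}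
    {C : Submodule R (E → R)} (hC : P.IsChainGroup C) {c : E → R} (hc : IsElementaryChain C c) :
    ∃ c' ∈ C, P.IsPrimitive c' ∧ Function.support c' = Function.support c := by
  obtain ⟨c', hc', hp, r, rfl⟩ := hC c hc
  refine ⟨c', hc', hp, ?_⟩
  have hr : r ≠ 0 := by
    rintro rfl
    exact hc.2.1 (zero_smul _ _)
  ext e
  simp only [Function.mem_support, Pi.smul_apply, smul_eq_mul, ne_eq]
  rcases hp e with h | ⟨g, -, h⟩
  · simp [h]
  · rw [h, Units.mul_left_eq_zero]
    have : Nontrivial R := ⟨r, 0, hr⟩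
    simp [hr]

/-- Weak elimination for the supports of elementary chains. -/
theorem SkewPartialField.IsChainGroup.elimination [Finite E] {P : SkewPartialField R}
    {C : Submodule R (E → R)} (hC : P.IsChainGroup C) (X Y : Set E)
    (hX : ∃ c, IsElementaryChain C c ∧ Function.support c = X)
    (hY : ∃ c, IsElementaryChain C c ∧ Function.support c = Y) (hXY : X ≠ Y)
    (e : E) (he : e ∈ X ∩ Y) :
    ∃ Z, (∃ c, IsElementaryChain C c ∧ Function.support c = Z) ∧ Z ⊆ (X ∪ Y) \ {e} := by
  obtain ⟨c₀, hc₀, rfl⟩ := hX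
  obtain ⟨d₀, hd₀, rfl⟩ := hY
  obtain ⟨c, hc, hcp, hcs⟩ := hC.exists_primitive hc₀
  obtain ⟨d, hd, hdp, hds⟩ := hC.exists_primitive hd₀
  rw [← hcs, ← hds] at hXY he ⊢
  obtain ⟨u, -, hu⟩ := (hcp e).resolve_left he.1
  obtain ⟨v, -, hv⟩ := (hdp e).resolve_left he.2
  set w : E → R := ((u⁻¹ : Rˣ) : R) • c - ((v⁻¹ : Rˣ) : R) • d with hw
  have hwe : ∀ f, w f = ((u⁻¹ : Rˣ) : R) * c f - ((v⁻¹ : Rˣ) : R) * d f := fun f => rfl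
  have hw0 : w ≠ 0 := by
    intro h0
    refine hXY (Set.ext fun f => ?_)
    have hf : ((u⁻¹ : Rˣ) : R) * c f = ((v⁻¹ : Rˣ) : R) * d f := by
      rw [← sub_eq_zero, ← hwe, h0]
      rfl
    rw [Function.mem_support, Function.mem_support, ne_eq, ne_eq,
      ← Units.mul_right_eq_zero u⁻¹, hf, Units.mul_right_eq_zero]
  obtain ⟨z, hz, hzs⟩ := exists_isElementaryChain_support_subset C
    (C.sub_mem (C.smul_mem _ hc) (C.smul_mem _ hd)) hw0
  refine ⟨_, ⟨z, hz, rfl⟩, fun f hf => ?_⟩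
  have hwf : w f ≠ 0 := hzs hf
  refine ⟨?_, ?_⟩
  · by_contra hno
    rw [Set.mem_union, not_or, Function.notMem_support, Function.notMem_support] at hno
    exact hwf (by rw [hwe, hno.1, hno.2, mul_zero, mul_zero, sub_zero])
  · rintro rfl
    exact hwf (by rw [hwe, hu, hv, Units.inv_mul, Units.inv_mul, sub_self])

/-- The matroid `M(C)` on `E` of a `P`-chain group `C`. Its cocircuits are the supports of the
elementary chains of `C`; so the independent sets of its dual are the sets containing no such
support. -/
def SkewPartialField.IsChainGroup.matroid [Finite E] {P : SkewPartialField R}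
    {C : Submodule R (E → R)} (hC : P.IsChainGroup C) : Matroid E :=
  (IndepMatroid.ofFinite (E := Set.univ) Set.finite_univ
    (fun I => ∀ X, (∃ c, IsElementaryChain C c ∧ Function.support c = X) → ¬ X ⊆ I)
    (by
      rintro X ⟨c, hc, rfl⟩ h
      exact hc.2.1 (Function.support_eq_empty_iff.1 (Set.subset_empty_iff.1 h)))
    (fun _ _ hJ hIJ X hX hXI => hJ X hX (hXI.trans hIJ))
    (fun _ _ hI hJ hlt => augment_of_elimination _ hC.elimination hI hJ hlt)
    (fun _ _ => Set.subset_univ _)).matroid✶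

theorem SkewPartialField.IsChainGroup.matroid_ground [Finite E] {P : SkewPartialField R}
    {C : Submodule R (E → R)} (hC : P.IsChainGroup C) : hC.matroid.E = Set.univ := rfl

theorem SkewPartialField.IsChainGroup.isCocircuit_matroid_iff [Finite E]
    {P : SkewPartialField R} {C : Submodule R (E → R)} (hC : P.IsChainGroup C) (X : Set E) :
    hC.matroid.IsCocircuit X ↔ ∃ c, IsElementaryChain C c ∧ Function.support c = X := by
  have hind : ∀ I : Set E, hC.matroid✶.Indep I ↔
      ∀ X, (∃ c, IsElementaryChain C c ∧ Function.support c = X) → ¬ X ⊆ I := by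
    intro I
    rw [SkewPartialField.IsChainGroup.matroid, Matroid.dual_dual]
    rfl
  rw [Matroid.isCocircuit_def, Matroid.isCircuit_iff_minimal_not_indep (Set.subset_univ _)]
  constructor
  · intro h
    have h1 := h.prop
    rw [hind] at h1
    push Not at h1
    obtain ⟨Y, hY, hYX⟩ := h1
    have : ¬ hC.matroid✶.Indep Y := fun hi => (hind Y).1 hi Y hY subset_rfl
    have hXY : X = Y := (hYX.antisymm (h.le_of_le this hYX)).symm
    rwa [hXY]
  · rintro ⟨c, hc, rfl⟩
    refine ⟨fun hi => (hind _).1 hi _ ⟨c, hc, rfl⟩ subset_rfl, fun Y hY hYc => ?_⟩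
    change ¬ hC.matroid✶.Indep Y at hY
    rw [hind] at hY
    push Not at hY
    obtain ⟨_, ⟨d, hd, rfl⟩, hdY⟩ := hY
    by_contra hno
    exact hc.2.2 ⟨d, hd.1, hd.2.1, hdY.trans hYc, fun h => hno (h.trans hdY)⟩

end ChainGroups

/-! ### Quaternionic unimodular chain groups -/

/-- The quaternionic unimodular skew partial field `(ℍ, {p : |p| = 1})`. -/
noncomputable def QU : SkewPartialField ℍ[ℝ] where
  G :=
    { carrier := {u | ‖(u : ℍ[ℝ])‖ = 1}
      mul_mem' := by
        intro a b ha hb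
        simp only [Set.mem_ofPred_eq, Units.val_mul, norm_mul] at *
        rw [ha, hb, mul_one]
      one_mem' := by simp
      inv_mem' := by
        intro a ha
        simp only [Set.mem_ofPred_eq, Units.val_inv_eq_inv_val, norm_inv] at *
        rw [ha, inv_one] }
  neg_one_mem := by
    change ‖((-1 : ℍ[ℝ]ˣ) : ℍ[ℝ])‖ = 1
    simp

/-- The ring homomorphism
`a + bi + cj + dk ↦ !![a + bi, c + di; -c + di, a - bi]` from `ℍ` to `M(2, ℂ)`. -/
noncomputable def quaternionPhi : ℍ[ℝ] →+* Matrix (Fin 2) (Fin 2) ℂ where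
  toFun p := !![⟨p.re, p.imI⟩, ⟨p.imJ, p.imK⟩; ⟨-p.imJ, p.imK⟩, ⟨p.re, -p.imI⟩]
  map_one' := by
    ext i j
    fin_cases i <;> fin_cases j <;> simp [Complex.ext_iff]
  map_zero' := by
    ext i j
    fin_cases i <;> fin_cases j <;> simp [Complex.ext_iff]
  map_add' p q := by
    ext i j
    fin_cases i <;> fin_cases j <;> simp [Complex.ext_iff, add_comm]
  map_mul' p q := by
    ext i j
    fin_cases i <;> fin_cases j <;>
      simp [Complex.ext_iff, Matrix.mul_apply, Fin.sum_univ_two] <;> constructor <;> ring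

/-- `δ(D) = √|det z₂(φ(D))|` for a square quaternionic matrix `D`, where `z₂` unwraps a matrix of
`2 × 2` blocks into a matrix of complex numbers. -/
noncomputable def quaternionDelta {X : Type*} [Fintype X] [DecidableEq X]
    (D : Matrix X X ℍ[ℝ]) : ℝ :=
  Real.sqrt ‖(Matrix.comp X X (Fin 2) (Fin 2) ℂ (D.map quaternionPhi)).det‖

/-! ### The projection matrix -/

/-- `P_A = A† (A A†)⁻¹ A`, for a quaternionic matrix `A` of full row rank. The inverse is the
one in the (noncommutative) ring of square quaternionic matrices. -/
noncomputable def rowProjection {X E : Type*} [Fintype X] [DecidableEq X] [Fintype E]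
    (A : Matrix X E ℍ[ℝ]) : Matrix E E ℍ[ℝ] :=
  Aᴴ * Ring.inverse (A * Aᴴ) * A

theorem vecMul_injective_of_linearIndependent {X E : Type*} [Fintype X] [Fintype E]
    {A : Matrix X E ℍ[ℝ]} (hA : LinearIndependent ℍ[ℝ] A.row) {x : X → ℍ[ℝ]}
    (hx : x ᵥ* A = 0) : x = 0 := by
  rw [Matrix.vecMul_eq_sum] at hx
  exact funext (Fintype.linearIndependent_iff.1 hA x hx)

theorem eq_one_of_mul_eq_self {Z E : Type*} [Fintype Z] [DecidableEq Z] [Fintype E]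
    {D : Matrix Z E ℍ[ℝ]} (hD : LinearIndependent ℍ[ℝ] D.row) {H : Matrix Z Z ℍ[ℝ]}
    (hH : H * D = D) : H = 1 := by
  rw [← sub_eq_zero]
  refine funext fun i => ?_
  apply vecMul_injective_of_linearIndependent hD
  rw [← Matrix.mul_apply_eq_vecMul, Matrix.sub_mul, hH, Matrix.one_mul, sub_self]
  rfl

/-- `A A†` is invertible if the rows of `A` are linearly independent, so the inverse in
`rowProjection` is a true inverse. -/
theorem isUnit_mul_conjTranspose {X E : Type*} [Fintype X] [DecidableEq X] [Fintype E]
    (A : Matrix X E ℍ[ℝ]) (hA : LinearIndependent ℍ[ℝ] A.row) : IsUnit (A * Aᴴ) := by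
  have hinj : ∀ x : X → ℍ[ℝ], x ᵥ* (A * Aᴴ) = 0 → x = 0 := by
    intro x hx
    apply vecMul_injective_of_linearIndependent hA
    have h0 : (x ᵥ* A) ⬝ᵥ star (x ᵥ* A) = 0 := by
      rw [Matrix.star_vecMul, Matrix.dotProduct_mulVec, Matrix.vecMul_vecMul, hx,
        zero_dotProduct]
    have h1 : ∑ e, Quaternion.normSq ((x ᵥ* A) e) = 0 := by
      apply Quaternion.coe_injective (R := ℝ)
      have h2 : ∀ e, (x ᵥ* A) e * star ((x ᵥ* A) e) =
          ((Quaternion.normSq ((x ᵥ* A) e) : ℝ) : ℍ[ℝ]) := fun e => Quaternion.self_mul_star _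
      simp only [dotProduct, Pi.star_apply, h2] at h0
      rw [Quaternion.coe_zero, ← h0]
      exact map_sum (algebraMap ℝ ℍ[ℝ]) _ _
    funext e
    exact Quaternion.normSq_eq_zero.1
      ((Finset.sum_eq_zero_iff_of_nonneg fun _ _ => Quaternion.normSq_nonneg).1 h1 e
        (Finset.mem_univ e))
  let f : (X → ℍ[ℝ]) →ₗ[ℍ[ℝ]] (X → ℍ[ℝ]) :=
    { toFun := fun x => x ᵥ* (A * Aᴴ)
      map_add' := fun x y => Matrix.add_vecMul _ _ _
      map_smul' := fun r x => Matrix.smul_vecMul _ _ _ }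
  have hf : Function.Surjective f :=
    LinearMap.injective_iff_surjective.1 ((injective_iff_map_eq_zero f).2 hinj)
  choose N hN using fun i : X => hf (Pi.single i 1)
  have h1 : Matrix.of N * (A * Aᴴ) = 1 := by
    refine funext fun i => funext fun j => ?_
    rw [Matrix.mul_apply_eq_vecMul]
    change f (N i) j = _
    rw [hN, Matrix.one_apply, Pi.single_apply]
    simp only [eq_comm]
  have h2 : (A * Aᴴ) * (Matrix.of N)ᴴ = 1 := by
    have := congrArg Matrix.conjTranspose h1
    rwa [Matrix.conjTranspose_mul, Matrix.conjTranspose_mul, Matrix.conjTranspose_conjTranspose,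
      Matrix.conjTranspose_one] at this
  exact isUnit_iff_exists_and_exists.2 ⟨⟨_, h2⟩, ⟨_, h1⟩⟩

/-- `P_A` depends only on the row span of `A`. -/
theorem rowProjection_eq {X Y E : Type*} [Fintype X] [DecidableEq X] [Fintype Y] [DecidableEq Y]
    [Fintype E] (A : Matrix X E ℍ[ℝ]) (B : Matrix Y E ℍ[ℝ])
    (hA : LinearIndependent ℍ[ℝ] A.row) (hB : LinearIndependent ℍ[ℝ] B.row)
    (hAB : Submodule.span ℍ[ℝ] (Set.range A.row) = Submodule.span ℍ[ℝ] (Set.range B.row)) :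
    rowProjection A = rowProjection B := by
  have exF : ∀ i, ∃ c : Y → ℍ[ℝ], ∑ j, c j • B.row j = A.row i := fun i =>
    (Submodule.mem_span_range_iff_exists_fun ℍ[ℝ]).1
      (hAB ▸ Submodule.subset_span (Set.mem_range_self i))
  have exG : ∀ i, ∃ c : X → ℍ[ℝ], ∑ j, c j • A.row j = B.row i := fun i =>
    (Submodule.mem_span_range_iff_exists_fun ℍ[ℝ]).1
      (hAB ▸ Submodule.subset_span (Set.mem_range_self i))
  choose F hF using exF
  choose G hG using exG
  have hFB : Matrix.of F * B = A := by
    refine funext fun i => ?_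
    rw [Matrix.mul_apply_eq_vecMul, Matrix.vecMul_eq_sum]
    exact hF i
  have hGA : Matrix.of G * A = B := by
    refine funext fun i => ?_
    rw [Matrix.mul_apply_eq_vecMul, Matrix.vecMul_eq_sum]
    exact hG i
  set F' := Matrix.of F
  set G' := Matrix.of G
  have hFG : F' * G' = 1 := eq_one_of_mul_eq_self hA (by rw [Matrix.mul_assoc, hGA, hFB])
  have hGF : G' * F' = 1 := eq_one_of_mul_eq_self hB (by rw [Matrix.mul_assoc, hFB, hGA])
  have hGF' : F'ᴴ * G'ᴴ = 1 := by
    rw [← Matrix.conjTranspose_mul, hGF, Matrix.conjTranspose_one]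
  have hM := isUnit_mul_conjTranspose B hB
  have hinv : Ring.inverse (A * Aᴴ) = G'ᴴ * Ring.inverse (B * Bᴴ) * G' := by
    have h1 : (A * Aᴴ) * (G'ᴴ * Ring.inverse (B * Bᴴ) * G') = 1 := by
      calc (A * Aᴴ) * (G'ᴴ * Ring.inverse (B * Bᴴ) * G')
          = F' * ((B * Bᴴ) * ((F'ᴴ * G'ᴴ) * Ring.inverse (B * Bᴴ))) * G' := by
            rw [← hFB, Matrix.conjTranspose_mul]
            simp only [Matrix.mul_assoc]
        _ = 1 := by
            rw [hGF', Matrix.one_mul, Ring.mul_inverse_cancel _ hM, Matrix.mul_one, hFG]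
    rw [← mul_one (Ring.inverse (A * Aᴴ)), ← h1, ← mul_assoc,
      Ring.inverse_mul_cancel _ (isUnit_mul_conjTranspose A hA), one_mul]
  calc rowProjection A
      = Bᴴ * ((F'ᴴ * G'ᴴ) * Ring.inverse (B * Bᴴ)) * (G' * F') * B := by
        rw [rowProjection, hinv]
        conv_lhs => rw [← hFB, Matrix.conjTranspose_mul]
        simp only [Matrix.mul_assoc]
    _ = rowProjection B := by
        rw [hGF', hGF, Matrix.one_mul, Matrix.mul_one, rowProjection]

/-- The projection matrix `P_C` of a chain group `C` over `ℍ`: the matrix `P_A`, where the rows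
of `A` form a basis of `C`. It does not depend on that basis, see `projectionMatrix_eq`. -/
noncomputable def projectionMatrix {E : Type*} [Fintype E] (C : Submodule ℍ[ℝ] (E → ℍ[ℝ])) :
    Matrix E E ℍ[ℝ] :=
  rowProjection (Matrix.of fun i => (Module.finBasis ℍ[ℝ] C i : E → ℍ[ℝ]))

/-- `P_C = P_A` for every matrix `A` of full row rank with row span `C`. -/
theorem projectionMatrix_eq {X E : Type*} [Fintype X] [DecidableEq X] [Fintype E]
    (C : Submodule ℍ[ℝ] (E → ℍ[ℝ])) (A : Matrix X E ℍ[ℝ]) (hA : LinearIndependent ℍ[ℝ] A.row)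
    (hC : Submodule.span ℍ[ℝ] (Set.range A.row) = C) :
    projectionMatrix C = rowProjection A := by
  refine rowProjection_eq _ _ ?_ hA ?_
  · exact (Module.finBasis ℍ[ℝ] C).linearIndependent.map' C.subtype C.ker_subtype
  · rw [hC]
    change Submodule.span ℍ[ℝ] (Set.range (C.subtype ∘ Module.finBasis ℍ[ℝ] C)) = C
    rw [Set.range_comp, Submodule.span_image, Module.Basis.span_eq, Submodule.map_top,
      Submodule.range_subtype]

/-! The proof contracts one element of `F` at a time and needs no noncommutative Cauchy-Binet
formula. Write `P` for the projection and `N(F)` for the number of bases containing `F`. If `e` is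
not a loop, the chains vanishing at `e` form a QU-chain group again. Its bases are the sets `B \
{e}` with `e ∈ B` a basis of `C`, and its projection is the Schur complement of `P` at the pivot `P
e e` (`IsProjection.downdate`). Since `δ` is multiplicative under Schur complements, `δ(P[F ∪ {e}])`
is `P e e` times `δ` of the contracted matrix on `F`. Induction on `F` thus reduces the theorem to
`re_mul_basisCount`: `P e e = N({e}) / N(∅)`.

That case is an induction on the rank. Both sides, summed over `e`, give the rank (`sum_re`,
`sum_basisCount`), so it suffices that `P e e` be proportional to `N({e})`. The induction hypothesis
for the contraction of `e` gives `(P e e * P f f - |P e f|²) N({e}) = P e e * N({e, f})`. The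
bracket and `N({e, f})` are symmetric in `e` and `f`, so exchanging them gives the proportionality
whenever some basis contains both. Parallel elements are compared through a third element. If there
is none, the rank is one, and there the unit norms of primitive chains give the claim. -/

/-! ### Contraction of chain groups, and counting bases. -/

section Contraction

variable {E : Type*}

/-- A set is determining if no nonzero chain vanishes on it. -/
def IsDetermining (C : Submodule ℍ[ℝ] (E → ℍ[ℝ])) (B : Set E) : Prop :=
  ∀ c ∈ C, (∀ e ∈ B, c e = 0) → c = 0

/-- The chains of `C` that vanish at `e`. -/
noncomputable def vanishingAt (C : Submodule ℍ[ℝ] (E → ℍ[ℝ])) (e : E) :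
    Submodule ℍ[ℝ] (E → ℍ[ℝ]) :=
  (LinearMap.ker ((LinearMap.proj e : (E → ℍ[ℝ]) →ₗ[ℍ[ℝ]] ℍ[ℝ]).comp C.subtype)).map C.subtype

theorem mem_vanishingAt {C : Submodule ℍ[ℝ] (E → ℍ[ℝ])} {e : E} {c : E → ℍ[ℝ]} :
    c ∈ vanishingAt C e ↔ c ∈ C ∧ c e = 0 := by
  simp [vanishingAt, and_comm]

/-- A chain with smaller support than `c` also vanishes at `e`, so elementary chains of the
contraction are elementary in `C`. The primitive chain obtained there vanishes at `e` because `ℍ`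
has no zero divisors. -/
theorem vanishingAt_isChainGroup {C : Submodule ℍ[ℝ] (E → ℍ[ℝ])} (hC : QU.IsChainGroup C)
    (e : E) : QU.IsChainGroup (vanishingAt C e) := by
  rintro c ⟨hc, hc0, hmin⟩
  obtain ⟨hcC, hce⟩ := mem_vanishingAt.1 hc
  obtain ⟨d, hd, hp, r, rfl⟩ := hC c ⟨hcC, hc0, by
    rintro ⟨d, hd, hd0, hlt⟩
    refine hmin ⟨d, mem_vanishingAt.2 ⟨hd, ?_⟩, hd0, hlt⟩
    by_contra h
    exact hlt.1 h hce⟩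
  refine ⟨d, mem_vanishingAt.2 ⟨hd, ?_⟩, hp, r, rfl⟩
  rcases mul_eq_zero.1 (show r * d e = 0 from hce) with h | h
  · exact absurd (by rw [h, zero_smul]) hc0
  · exact h

theorem finrank_vanishingAt [Finite E] {C : Submodule ℍ[ℝ] (E → ℍ[ℝ])} {e : E}
    (he : ∃ c ∈ C, c e ≠ 0) :
    Module.finrank ℍ[ℝ] (vanishingAt C e) + 1 = Module.finrank ℍ[ℝ] C := by
  have := Fintype.ofFinite E
  rw [vanishingAt, Submodule.finrank_map_subtype_eq, add_comm]
  set f := (LinearMap.proj e : (E → ℍ[ℝ]) →ₗ[ℍ[ℝ]] ℍ[ℝ]).comp C.subtype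
  rw [← LinearMap.finrank_range_add_finrank_ker f]
  have hf : LinearMap.range f = ⊤ := by
    rw [LinearMap.range_eq_top]
    intro x
    obtain ⟨c, hc, hce⟩ := he
    refine ⟨(x * (c e)⁻¹) • ⟨c, hc⟩, ?_⟩
    change x * (c e)⁻¹ * c e = x
    rw [mul_assoc, inv_mul_cancel₀ hce, mul_one]
  rw [hf, finrank_top, Module.finrank_self]

theorem isDetermining_vanishingAt {C : Submodule ℍ[ℝ] (E → ℍ[ℝ])} {e : E} {B : Set E} :
    IsDetermining (vanishingAt C e) B ↔ IsDetermining C (insert e B) := by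
  simp only [IsDetermining, mem_vanishingAt, Set.forall_mem_insert]
  grind

theorem IsDetermining.finrank_le {C : Submodule ℍ[ℝ] (E → ℍ[ℝ])} {B : Finset E}
    (hB : IsDetermining C B) : Module.finrank ℍ[ℝ] C ≤ B.card := by
  let f : C →ₗ[ℍ[ℝ]] (B → ℍ[ℝ]) :=
    (LinearMap.pi fun b : B => LinearMap.proj (b : E)).comp C.subtype
  have hf : Function.Injective f := by
    rw [injective_iff_map_eq_zero]
    rintro ⟨c, hc⟩ h
    exact Subtype.ext (hB c hc fun e he => congrFun h ⟨e, he⟩)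
  simpa using LinearMap.finrank_le_finrank_of_injective hf

/-- Determining sets of size the dimension of `C`. -/
def IsChainBasis (C : Submodule ℍ[ℝ] (E → ℍ[ℝ])) (B : Finset E) : Prop :=
  IsDetermining C B ∧ B.card = Module.finrank ℍ[ℝ] C

theorem IsChainBasis.exists_ne_zero [DecidableEq E] {C : Submodule ℍ[ℝ] (E → ℍ[ℝ])}
    {B : Finset E} (hB : IsChainBasis C B) {e : E} (he : e ∈ B) : ∃ c ∈ C, c e ≠ 0 := by
  by_contra! h
  have h1 : IsDetermining C (B.erase e : Finset E) := by
    intro c hc hcB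
    refine hB.1 c hc fun f hf => ?_
    by_cases hfe : f = e
    · rw [hfe]
      exact h c hc
    · exact hcB f (by simpa [hfe] using hf)
  have h2 := h1.finrank_le
  have := Finset.card_erase_lt_of_mem he
  have := hB.2
  omega

/-- These are the bases of the contraction by the non-loop `e`: adjoining `e` to a determining set
makes up for the condition `c e = 0`, and the dimension drops by exactly one. -/
theorem isChainBasis_vanishingAt [Finite E] [DecidableEq E] {C : Submodule ℍ[ℝ] (E → ℍ[ℝ])}
    {e : E} (he : ∃ c ∈ C, c e ≠ 0) {B : Finset E} :
    IsChainBasis (vanishingAt C e) B ↔ e ∉ B ∧ IsChainBasis C (insert e B) := by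
  have hr := finrank_vanishingAt he
  constructor
  · intro h
    have heB : e ∉ B := by
      intro heB
      obtain ⟨c, hc, hce⟩ := h.exists_ne_zero heB
      exact hce (mem_vanishingAt.1 hc).2
    refine ⟨heB, ?_, ?_⟩
    · rw [Finset.coe_insert]
      exact isDetermining_vanishingAt.1 h.1
    · rw [Finset.card_insert_of_notMem heB, h.2, hr]
  · rintro ⟨heB, h1, h2⟩
    rw [Finset.coe_insert] at h1
    rw [Finset.card_insert_of_notMem heB] at h2
    exact ⟨isDetermining_vanishingAt.2 h1, by omega⟩

theorem exists_apply_ne_zero_of_finrank_pos {C : Submodule ℍ[ℝ] (E → ℍ[ℝ])}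
    (h : 0 < Module.finrank ℍ[ℝ] C) : ∃ e, ∃ c ∈ C, c e ≠ 0 := by
  by_contra! hno
  have : C = ⊥ := (Submodule.eq_bot_iff _).2 fun c hc => funext fun e => hno e c hc
  rw [this, finrank_bot] at h
  exact h.false

variable [Fintype E] [DecidableEq E]

open Classical in
/-- The number of bases containing `F`. -/
noncomputable def basisCount (C : Submodule ℍ[ℝ] (E → ℍ[ℝ])) (F : Finset E) : ℕ :=
  (Finset.univ.filter fun B : Finset E => IsChainBasis C B ∧ F ⊆ B).card

theorem basisCount_vanishingAt {C : Submodule ℍ[ℝ] (E → ℍ[ℝ])} {e : E}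
    (he : ∃ c ∈ C, c e ≠ 0) {F : Finset E} (heF : e ∉ F) :
    basisCount (vanishingAt C e) F = basisCount C (insert e F) := by
  classical
  refine Finset.card_nbij' (fun B => insert e B) (fun B => B.erase e) ?_ ?_ ?_ ?_
  · intro B hB
    simp only [Finset.coe_filter, Finset.mem_univ, true_and, Set.mem_ofPred_eq] at hB ⊢
    exact ⟨((isChainBasis_vanishingAt he).1 hB.1).2, Finset.insert_subset_insert _ hB.2⟩
  · intro B hB
    simp only [Finset.coe_filter, Finset.mem_univ, true_and, Set.mem_ofPred_eq] at hB ⊢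
    have heB : e ∈ B := hB.2 (Finset.mem_insert_self _ _)
    refine ⟨(isChainBasis_vanishingAt he).2 ⟨Finset.notMem_erase _ _, ?_⟩, ?_⟩
    · rw [Finset.insert_erase heB]
      exact hB.1
    · exact Finset.subset_erase.2 ⟨(Finset.subset_insert _ _).trans hB.2, heF⟩
  · intro B hB
    simp only [Finset.coe_filter, Finset.mem_univ, true_and, Set.mem_ofPred_eq] at hB
    exact Finset.erase_insert ((isChainBasis_vanishingAt he).1 hB.1).1
  · intro B hB
    simp only [Finset.coe_filter, Finset.mem_univ, true_and, Set.mem_ofPred_eq] at hB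
    exact Finset.insert_erase (hB.2 (Finset.mem_insert_self _ _))

theorem basisCount_eq_zero {C : Submodule ℍ[ℝ] (E → ℍ[ℝ])} {e : E}
    (he : ∀ c ∈ C, c e = 0) {F : Finset E} (heF : e ∈ F) : basisCount C F = 0 := by
  classical
  rw [basisCount, Finset.card_eq_zero, Finset.filter_eq_empty_iff]
  rintro B - ⟨hB, hF⟩
  obtain ⟨c, hc, hce⟩ := hB.exists_ne_zero (hF heF)
  exact hce (he c hc)

theorem exists_isChainBasis (C : Submodule ℍ[ℝ] (E → ℍ[ℝ])) : ∃ B, IsChainBasis C B := by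
  induction hn : Module.finrank ℍ[ℝ] C generalizing C with
  | zero =>
    refine ⟨∅, fun c hc _ => ?_, by simp [hn]⟩
    rw [Submodule.finrank_eq_zero.1 hn] at hc
    exact hc
  | succ n ih =>
    obtain ⟨e, he⟩ := exists_apply_ne_zero_of_finrank_pos (C := C) (by omega)
    obtain ⟨B, hB⟩ := ih (vanishingAt C e) (by have := finrank_vanishingAt he; omega)
    exact ⟨_, ((isChainBasis_vanishingAt he).1 hB).2⟩

theorem basisCount_empty_pos (C : Submodule ℍ[ℝ] (E → ℍ[ℝ])) : 0 < basisCount C ∅ := by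
  classical
  obtain ⟨B, hB⟩ := exists_isChainBasis C
  exact Finset.card_pos.2 ⟨B, by simpa using hB⟩

theorem basisCount_singleton_pos {C : Submodule ℍ[ℝ] (E → ℍ[ℝ])} {e : E}
    (he : ∃ c ∈ C, c e ≠ 0) : 0 < basisCount C {e} := by
  have := basisCount_vanishingAt he (Finset.notMem_empty e)
  rw [insert_empty_eq] at this
  rw [← this]
  exact basisCount_empty_pos _

/-- The second hypothesis says that `f` is still not a loop after `e` has been contracted. -/
theorem basisCount_pair_pos {C : Submodule ℍ[ℝ] (E → ℍ[ℝ])} {e f : E}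
    (he : ∃ c ∈ C, c e ≠ 0) (hf : ∃ c ∈ C, c e = 0 ∧ c f ≠ 0) : 0 < basisCount C {e, f} := by
  obtain ⟨c, hc, hce, hcf⟩ := hf
  have hef : e ∉ ({f} : Finset E) := by
    rw [Finset.mem_singleton]
    rintro rfl
    exact hcf hce
  rw [← basisCount_vanishingAt he hef]
  exact basisCount_singleton_pos ⟨c, mem_vanishingAt.2 ⟨hc, hce⟩, hcf⟩

theorem basisCount_singleton_of_finrank_eq_one {C : Submodule ℍ[ℝ] (E → ℍ[ℝ])}
    (hr : Module.finrank ℍ[ℝ] C = 1) {e : E} (he : ∃ c ∈ C, c e ≠ 0) : basisCount C {e} = 1 := by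
  classical
  have h := basisCount_vanishingAt he (Finset.notMem_empty e)
  rw [insert_empty_eq] at h
  rw [← h, basisCount]
  have h0 : Module.finrank ℍ[ℝ] (vanishingAt C e) = 0 := by
    have := finrank_vanishingAt he
    omega
  rw [Finset.card_eq_one]
  refine ⟨∅, Finset.eq_singleton_iff_unique_mem.2 ⟨?_, ?_⟩⟩
  · obtain ⟨B, hB⟩ := exists_isChainBasis (vanishingAt C e)
    have : B = ∅ := Finset.card_eq_zero.1 (hB.2.trans h0)
    subst this
    simpa using hB
  · intro B hB
    simp only [Finset.mem_filter, Finset.mem_univ, true_and] at hB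
    exact Finset.card_eq_zero.1 (hB.1.2.trans h0)

/-- Double counting of the pairs `(e, B)` with `e ∈ B`. -/
theorem sum_basisCount (C : Submodule ℍ[ℝ] (E → ℍ[ℝ])) :
    ∑ e, basisCount C {e} = Module.finrank ℍ[ℝ] C * basisCount C ∅ := by
  classical
  simp only [basisCount, Finset.singleton_subset_iff, Finset.empty_subset, and_true]
  simp only [← Finset.filter_filter]
  have := Finset.sum_card_bipartiteAbove_eq_sum_card_bipartiteBelow
    (s := (Finset.univ : Finset E)) (t := Finset.univ.filter fun B : Finset E => IsChainBasis C B)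
    (fun e B => e ∈ B)
  simp only [Finset.bipartiteAbove, Finset.bipartiteBelow] at this
  rw [this, mul_comm, ← smul_eq_mul]
  refine Finset.sum_eq_card_nsmul fun B hB => ?_
  rw [← (Finset.mem_filter.1 hB).2.2]
  simp

end Contraction

/-! ### Bases of `M(C)` as determining sets. -/

section MatroidBases

variable {E : Type*} [Fintype E]

/-- Every nonzero chain has the support of an elementary chain inside its own, so testing elementary
chains is enough. -/
theorem isDetermining_iff_no_support {C : Submodule ℍ[ℝ] (E → ℍ[ℝ])} {I : Set E} :
    (∀ X, (∃ c, IsElementaryChain C c ∧ Function.support c = X) → ¬ X ⊆ I) ↔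
      IsDetermining C Iᶜ := by
  constructor
  · intro h c hc hcI
    by_contra hc0
    obtain ⟨d, hd, hdc⟩ := exists_isElementaryChain_support_subset C hc hc0
    refine h _ ⟨d, hd, rfl⟩ (hdc.trans fun x hx => ?_)
    by_contra hxI
    exact hx (hcI x hxI)
  · rintro h _ ⟨c, hc, rfl⟩ hcI
    refine hc.2.1 (h c hc.1 fun e he => ?_)
    by_contra h0
    exact he (hcI h0)

theorem dual_indep_iff {C : Submodule ℍ[ℝ] (E → ℍ[ℝ])} (hC : QU.IsChainGroup C) {I : Set E} :
    hC.matroid✶.Indep I ↔ IsDetermining C Iᶜ := by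
  rw [← isDetermining_iff_no_support, SkewPartialField.IsChainGroup.matroid, Matroid.dual_dual]
  rfl

theorem isBase_iff_minimal {C : Submodule ℍ[ℝ] (E → ℍ[ℝ])} (hC : QU.IsChainGroup C) {B : Set E} :
    hC.matroid.IsBase B ↔ Minimal (IsDetermining C) B := by
  have h1 : hC.matroid.IsBase B ↔ hC.matroid✶.IsBase Bᶜ := by
    rw [Matroid.dual_isBase_iff', hC.matroid_ground, ← Set.compl_eq_univ_sdiff, compl_compl]
    simp
  rw [h1, Matroid.isBase_iff_maximal_indep]
  simp only [Maximal, Minimal, dual_indep_iff, compl_compl]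
  refine and_congr_right fun _ => ⟨fun h X hX hXB => ?_, fun h X hX hXB => ?_⟩
  · have := h (y := Xᶜ) (by simpa using hX) (Set.compl_subset_compl.2 hXB)
    exact Set.compl_subset_compl.1 this
  · have := h hX (Set.compl_subset_comm.1 hXB)
    exact Set.subset_compl_comm.1 this

theorem IsChainBasis.isBase {C : Submodule ℍ[ℝ] (E → ℍ[ℝ])} (hC : QU.IsChainGroup C)
    {B : Finset E} (hB : IsChainBasis C B) : hC.matroid.IsBase (B : Set E) := by
  classical
  rw [isBase_iff_minimal]
  refine ⟨hB.1, fun X hX hXB => ?_⟩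
  have hX' : IsDetermining C (X.toFinset : Finset E) := by simpa using hX
  have h1 : X.toFinset ⊆ B := by
    intro x hx
    exact hXB (Set.mem_toFinset.1 hx)
  have h2 := Finset.eq_of_subset_of_card_le h1 (hB.2 ▸ hX'.finrank_le)
  rw [← h2]
  simp

variable [DecidableEq E]

/-- A base is a minimal determining set, whose size is not evident; it is found by comparison with
one base known to have `finrank` elements. -/
theorem isBase_iff_isChainBasis {C : Submodule ℍ[ℝ] (E → ℍ[ℝ])} (hC : QU.IsChainGroup C)
    {B : Finset E} : hC.matroid.IsBase (B : Set E) ↔ IsChainBasis C B := by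
  refine ⟨fun h => ⟨((isBase_iff_minimal hC).1 h).prop, ?_⟩, fun h => h.isBase hC⟩
  obtain ⟨B₀, h₀⟩ := exists_isChainBasis C
  have := h.ncard_eq_ncard_of_isBase (h₀.isBase hC)
  rw [Set.ncard_coe_finset, Set.ncard_coe_finset] at this
  rw [this, h₀.2]

theorem ncard_isBase {C : Submodule ℍ[ℝ] (E → ℍ[ℝ])} (hC : QU.IsChainGroup C) (F : Finset E) :
    {B : Set E | hC.matroid.IsBase B ∧ (F : Set E) ⊆ B}.ncard = basisCount C F := by
  classical
  rw [basisCount, ← Set.ncard_coe_finset]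
  symm
  refine Set.ncard_congr (fun B _ => (B : Set E)) ?_ ?_ ?_
  · intro B hB
    simp only [Finset.coe_filter, Finset.mem_univ, true_and, Set.mem_ofPred_eq] at hB
    exact ⟨(isBase_iff_isChainBasis hC).2 hB.1, Finset.coe_subset.2 hB.2⟩
  · intro B B' _ _ h
    exact Finset.coe_injective h
  · intro B hB
    refine ⟨B.toFinset, ?_, by simp⟩
    simp only [Finset.coe_filter, Finset.mem_univ, true_and, Set.mem_ofPred_eq]
    rw [← isBase_iff_isChainBasis hC, ← Finset.coe_subset]
    simpa using hB

end MatroidBases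

/-! ### Orthogonal projections and their diagonal entries. -/

section Projection

variable {E : Type*}

/-- The rank one downdate of `P` at `e`. -/
noncomputable def downdate (P : Matrix E E ℍ[ℝ]) (e : E) : Matrix E E ℍ[ℝ] :=
  Matrix.of fun f g => P f g - P f e * ((((P e e).re)⁻¹ : ℝ) : ℍ[ℝ]) * P e g

theorem downdate_apply (P : Matrix E E ℍ[ℝ]) (e f g : E) :
    downdate P e f g = P f g - P f e * ((((P e e).re)⁻¹ : ℝ) : ℍ[ℝ]) * P e g := rfl

/-- `C` is spanned by one primitive chain, whose entries off the loops have norm 1. Only here does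
the norm condition in `QU` enter. -/
theorem norm_apply_eq_of_finrank_eq_one {C : Submodule ℍ[ℝ] (E → ℍ[ℝ])} (hC : QU.IsChainGroup C)
    (hr : Module.finrank ℍ[ℝ] C = 1) {e f : E} (he : ∃ c ∈ C, c e ≠ 0) (hf : ∃ c ∈ C, c f ≠ 0)
    {d : E → ℍ[ℝ]} (hd : d ∈ C) : ‖d e‖ = ‖d f‖ := by
  obtain ⟨v, hv0, hv⟩ := finrank_eq_one_iff'.1 hr
  have hv' : ∀ c ∈ C, ∃ a : ℍ[ℝ], c = a • (v : E → ℍ[ℝ]) := fun c hc => by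
    obtain ⟨a, ha⟩ := hv ⟨c, hc⟩
    exact ⟨a, (congrArg Subtype.val ha).symm⟩
  have hel : IsElementaryChain C (v : E → ℍ[ℝ]) := by
    refine ⟨v.2, fun h => hv0 (Subtype.ext h), ?_⟩
    rintro ⟨c, hc, hc0, hlt⟩
    obtain ⟨a, rfl⟩ := hv' c hc
    refine hlt.2 fun x hx => ?_
    have ha : a ≠ 0 := by
      rintro rfl
      exact hc0 (zero_smul _ _)
    exact mul_ne_zero ha hx
  obtain ⟨w, hw, hp, r, hvw⟩ := hC _ hel
  have hw' : ∀ c ∈ C, ∃ a : ℍ[ℝ], c = a • w := fun c hc => by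
    obtain ⟨a, rfl⟩ := hv' c hc
    exact ⟨a * r, by rw [hvw, smul_smul]⟩
  have hw1 : ∀ x, (∃ c ∈ C, c x ≠ 0) → ‖w x‖ = 1 := by
    rintro x ⟨c, hc, hcx⟩
    obtain ⟨a, rfl⟩ := hw' c hc
    rcases hp x with h0 | ⟨g, hg, hx⟩
    · exact absurd (show a * w x = 0 by rw [h0, mul_zero]) hcx
    · rw [hx]
      exact hg
  obtain ⟨a, rfl⟩ := hw' d hd
  simp only [Pi.smul_apply, smul_eq_mul, norm_mul, hw1 e he, hw1 f hf]

variable [Fintype E]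

/-- `P` is the matrix of the orthogonal projection onto `C`, acting on row vectors. -/
structure IsProjection (C : Submodule ℍ[ℝ] (E → ℍ[ℝ])) (P : Matrix E E ℍ[ℝ]) : Prop where
  star_apply : ∀ e f, star (P e f) = P f e
  row_mem : ∀ e, P e ∈ C
  vecMul : ∀ c ∈ C, c ᵥ* P = c

theorem isProjection_rowProjection {X : Type*} [Fintype X] [DecidableEq X]
    (A : Matrix X E ℍ[ℝ]) (hA : LinearIndependent ℍ[ℝ] A.row) :
    IsProjection (Submodule.span ℍ[ℝ] (Set.range A.row)) (rowProjection A) := by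
  have hU := isUnit_mul_conjTranspose A hA
  have hS : (Ring.inverse (A * Aᴴ))ᴴ = Ring.inverse (A * Aᴴ) := by
    have h1 : (Ring.inverse (A * Aᴴ))ᴴ * (A * Aᴴ) = 1 := by
      have := congrArg Matrix.conjTranspose (Ring.mul_inverse_cancel _ hU)
      simpa only [Matrix.conjTranspose_mul, Matrix.conjTranspose_conjTranspose,
        Matrix.conjTranspose_one] using this
    rw [← mul_one (Ring.inverse (A * Aᴴ))ᴴ, ← Ring.mul_inverse_cancel _ hU, ← mul_assoc, h1,
      one_mul]
  refine ⟨fun e f => ?_, fun e => ?_, fun c hc => ?_⟩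
  · have : (rowProjection A)ᴴ = rowProjection A := by
      simp only [rowProjection, Matrix.conjTranspose_mul, hS, Matrix.conjTranspose_conjTranspose,
        Matrix.mul_assoc]
    rw [← Matrix.conjTranspose_apply, this]
  · rw [rowProjection, Matrix.mul_apply_eq_vecMul, Matrix.vecMul_eq_sum]
    exact Submodule.sum_mem _ fun i _ =>
      Submodule.smul_mem _ _ (Submodule.subset_span (Set.mem_range_self i))
  · obtain ⟨x, rfl⟩ := (Submodule.mem_span_range_iff_exists_fun ℍ[ℝ]).1 hc
    have hx : ∑ i, x i • A.row i = x ᵥ* A := (Matrix.vecMul_eq_sum _ _).symm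
    rw [hx, Matrix.vecMul_vecMul, rowProjection, ← Matrix.mul_assoc, ← Matrix.mul_assoc,
      Ring.mul_inverse_cancel _ hU, Matrix.one_mul]

theorem isProjection_projectionMatrix (C : Submodule ℍ[ℝ] (E → ℍ[ℝ])) :
    IsProjection C (projectionMatrix C) := by
  have h := isProjection_rowProjection
    (Matrix.of fun i => (Module.finBasis ℍ[ℝ] C i : E → ℍ[ℝ]))
    ((Module.finBasis ℍ[ℝ] C).linearIndependent.map' C.subtype C.ker_subtype)
  have hspan : Submodule.span ℍ[ℝ] (Set.range (Matrix.of fun i =>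
      (Module.finBasis ℍ[ℝ] C i : E → ℍ[ℝ])).row) = C := by
    change Submodule.span ℍ[ℝ] (Set.range (C.subtype ∘ Module.finBasis ℍ[ℝ] C)) = C
    rw [Set.range_comp, Submodule.span_image, Module.Basis.span_eq, Submodule.map_top,
      Submodule.range_subtype]
  rwa [hspan] at h

namespace IsProjection

variable {C : Submodule ℍ[ℝ] (E → ℍ[ℝ])} {P : Matrix E E ℍ[ℝ]}

theorem apply_self (h : IsProjection C P) (e : E) : P e e = (((P e e).re : ℝ) : ℍ[ℝ]) :=
  Quaternion.star_eq_self.1 (h.star_apply e e)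

theorem mul_swap (h : IsProjection C P) (e f : E) :
    P e f * P f e = ((Quaternion.normSq (P e f) : ℝ) : ℍ[ℝ]) := by
  rw [← h.star_apply e f, Quaternion.self_mul_star]

theorem normSq_swap (h : IsProjection C P) (e f : E) :
    Quaternion.normSq (P e f) = Quaternion.normSq (P f e) := by
  rw [← h.star_apply e f, Quaternion.normSq_star]

/-- Row `e` lies in `C` and so is fixed by `P`; its entry at `e`, by hermitian symmetry, is a sum of
squared norms. -/
theorem re_apply_self (h : IsProjection C P) (e : E) :
    (P e e).re = ∑ f, Quaternion.normSq (P e f) := by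
  have h1 := congrFun (h.vecMul _ (h.row_mem e)) e
  simp only [Matrix.vecMul, dotProduct, h.mul_swap] at h1
  apply Quaternion.coe_injective (R := ℝ)
  rw [← h.apply_self, ← h1]
  exact (map_sum (algebraMap ℝ ℍ[ℝ]) _ _).symm

theorem apply_eq_zero (h : IsProjection C P) {e : E} (he : (P e e).re = 0) :
    ∀ c ∈ C, c e = 0 := by
  intro c hc
  have h0 : ∀ f, P f e = 0 := by
    intro f
    rw [h.re_apply_self] at he
    have := (Finset.sum_eq_zero_iff_of_nonneg fun _ _ => Quaternion.normSq_nonneg).1 he f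
      (Finset.mem_univ f)
    rw [h.normSq_swap] at this
    exact Quaternion.normSq_eq_zero.1 this
  rw [← h.vecMul c hc]
  simp [Matrix.vecMul, dotProduct, h0]

theorem exists_ne_zero (h : IsProjection C P) {e : E} (he : (P e e).re ≠ 0) :
    ∃ c ∈ C, c e ≠ 0 :=
  ⟨P e, h.row_mem e, fun h0 => he (by rw [h0]; rfl)⟩

theorem re_eq_zero (h : IsProjection C P) {e : E} (he : ∀ c ∈ C, c e = 0) :
    (P e e).re = 0 := by
  rw [he _ (h.row_mem e)]
  rfl

theorem norm_apply_self (h : IsProjection C P) (e : E) : ‖P e e‖ = (P e e).re := by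
  have h0 : 0 ≤ (P e e).re := by
    rw [h.re_apply_self]
    exact Finset.sum_nonneg fun _ _ => Quaternion.normSq_nonneg
  conv_lhs => rw [h.apply_self e]
  rw [Quaternion.norm_coe, Real.norm_of_nonneg h0]

end IsProjection

namespace IsProjection

variable {C : Submodule ℍ[ℝ] (E → ℍ[ℝ])} {P : Matrix E E ℍ[ℝ]}

/-- The pivot is real, hence central, so the correction clears column `e` and keeps the matrix
hermitian. On a chain `c` with `c e = 0` the correction contributes nothing, since `c ᵥ* P` already
vanishes at `e`. -/
theorem downdate (h : IsProjection C P) {e : E} (he : (P e e).re ≠ 0) :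
    IsProjection (vanishingAt C e) (downdate P e) := by
  refine ⟨fun f g => ?_, fun f => ?_, fun c hc => ?_⟩
  · rw [downdate_apply, downdate_apply, star_sub, star_mul, star_mul, h.star_apply, h.star_apply,
      h.star_apply, Quaternion.star_coe, mul_assoc]
  · refine mem_vanishingAt.2 ⟨?_, ?_⟩
    · exact C.sub_mem (h.row_mem f) (C.smul_mem (P f e * _) (h.row_mem e))
    · rw [downdate_apply, mul_assoc]
      conv_lhs => rw [h.apply_self e]
      rw [Quaternion.re_coe, ← Quaternion.coe_mul, inv_mul_cancel₀ he, Quaternion.coe_one, mul_one,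
        sub_self]
  · obtain ⟨hc, hce⟩ := mem_vanishingAt.1 hc
    have h1 := h.vecMul c hc
    have h2 : ∑ f, c f * P f e = 0 := by rw [← hce]; exact congrFun h1 e
    funext g
    conv_rhs => rw [← congrFun h1 g]
    simp only [Matrix.vecMul, dotProduct, downdate_apply, mul_sub, Finset.sum_sub_distrib,
      ← mul_assoc, ← Finset.sum_mul, h2, zero_mul, sub_zero]

theorem re_downdate (h : IsProjection C P) (e f : E) :
    (_root_.downdate P e f f).re =
      (P f f).re - ((P e e).re)⁻¹ * Quaternion.normSq (P e f) := by
  rw [downdate_apply, ← Quaternion.coe_commutes, mul_assoc, h.mul_swap, ← Quaternion.coe_mul,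
    Quaternion.re_sub, Quaternion.re_coe, h.normSq_swap]

/-- Each downdate lowers the trace by `(∑ f, |P e f|²) / P e e`, which is 1 by `re_apply_self`, and
lowers the dimension by 1. -/
theorem sum_re (h : IsProjection C P) :
    ∑ e, (P e e).re = Module.finrank ℍ[ℝ] C := by
  classical
  induction hn : Module.finrank ℍ[ℝ] C generalizing C P with
  | zero =>
    rw [Nat.cast_zero]
    refine Finset.sum_eq_zero fun e _ => h.re_eq_zero fun c hc => ?_
    rw [Submodule.finrank_eq_zero.1 hn] at hc
    rw [(Submodule.mem_bot _).1 hc]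
    rfl
  | succ n ih =>
    obtain ⟨e, he⟩ := exists_apply_ne_zero_of_finrank_pos (C := C) (by omega)
    have hp : (P e e).re ≠ 0 := by
      obtain ⟨c, hc, hce⟩ := he
      exact fun h0 => hce (h.apply_eq_zero h0 c hc)
    have := ih (h.downdate hp) (by have := finrank_vanishingAt he; omega)
    simp only [h.re_downdate, Finset.sum_sub_distrib, ← Finset.mul_sum, ← h.re_apply_self,
      inv_mul_cancel₀ hp] at this
    push_cast
    linarith

end IsProjection

variable [DecidableEq E]

/-- The diagonal entries of the projection are proportional to the numbers of bases through the
elements. -/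
theorem re_mul_basisCount_comm {C : Submodule ℍ[ℝ] (E → ℍ[ℝ])} {P : Matrix E E ℍ[ℝ]}
    (hC : QU.IsChainGroup C) (h : IsProjection C P)
    (ih : ∀ e, (P e e).re ≠ 0 → ∀ f, (downdate P e f f).re * basisCount (vanishingAt C e) ∅ =
      basisCount (vanishingAt C e) {f}) (e f : E) :
    (P e e).re * basisCount C {f} = (P f f).re * basisCount C {e} := by
  by_cases hpe : (P e e).re = 0
  · rw [hpe, basisCount_eq_zero (h.apply_eq_zero hpe) (Finset.mem_singleton_self e)]
    simp
  by_cases hpf : (P f f).re = 0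
  · rw [hpf, basisCount_eq_zero (h.apply_eq_zero hpf) (Finset.mem_singleton_self f)]
    simp
  -- The induction hypothesis for the contraction of `e`, read at `f` and cleared of the denominator
  -- `P e e`.
  have step : ∀ e f, (P e e).re ≠ 0 → e ≠ f →
      ((P e e).re * (P f f).re - Quaternion.normSq (P e f)) * basisCount C {e} =
        (P e e).re * basisCount C {e, f} := by
    intro e f hpe hef
    have h1 := ih e hpe f
    rw [basisCount_vanishingAt (h.exists_ne_zero hpe) (F := {f}) (by simp [hef]),
      basisCount_vanishingAt (h.exists_ne_zero hpe) (Finset.notMem_empty e), insert_empty_eq,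
      h.re_downdate] at h1
    rw [← h1, ← mul_assoc, mul_sub, mul_inv_cancel_left₀ hpe]
  have main : ∀ e f, (P e e).re ≠ 0 → (P f f).re ≠ 0 → e ≠ f → 0 < basisCount C {e, f} →
      (P e e).re * basisCount C {f} = (P f f).re * basisCount C {e} := by
    intro e f hpe hpf hef hpos
    have h1 := step e f hpe hef
    have h2 := step f e hpf hef.symm
    rw [Finset.pair_comm, h.normSq_swap f e] at h2
    have hpos' : (basisCount C {e, f} : ℝ) ≠ 0 := by positivity
    apply mul_right_cancel₀ hpos'
    -- Both instances of `step` share the 2×2 minor and the pair count; eliminating the minor leaves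
    -- the claim times the pair count.
    linear_combination (-(basisCount C {f} : ℝ)) * h1 + (basisCount C {e} : ℝ) * h2
  have he := h.exists_ne_zero hpe
  have hf := h.exists_ne_zero hpf
  by_cases hef : e = f
  · rw [hef]
  by_cases hpos : 0 < basisCount C {e, f}
  · exact main e f hpe hpf hef hpos
  -- No basis contains both elements, so they are parallel.
  have hpar : ∀ c ∈ C, c e = 0 → c f = 0 := by
    intro c hc hce
    by_contra hcf
    exact hpos (basisCount_pair_pos he ⟨c, hc, hce, hcf⟩)
  -- A non-loop `g` not parallel to `e` is not parallel to `f` either, and serves as intermediary.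
  by_cases hex : ∃ g, ∃ c ∈ C, c e = 0 ∧ c g ≠ 0
  · obtain ⟨g, c, hc, hce, hcg⟩ := hex
    have hpg : (P g g).re ≠ 0 := fun h0 => hcg (h.apply_eq_zero h0 c hc)
    have h1 := main e g hpe hpg (by rintro rfl; exact hcg hce)
      (basisCount_pair_pos he ⟨c, hc, hce, hcg⟩)
    have h2 := main f g hpf hpg (by rintro rfl; exact hcg (hpar c hc hce))
      (basisCount_pair_pos hf ⟨c, hc, hpar c hc hce, hcg⟩)
    apply mul_left_cancel₀ hpg
    linear_combination (P f f).re * h1 - (P e e).re * h2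
  · push Not at hex
    have hr : Module.finrank ℍ[ℝ] C = 1 := by
      rw [← finrank_vanishingAt he]
      have : vanishingAt C e = ⊥ := (Submodule.eq_bot_iff _).2 fun c hc => funext fun g =>
        hex g c (mem_vanishingAt.1 hc).1 (mem_vanishingAt.1 hc).2
      rw [this, finrank_bot]
    -- In rank one both counts are 1, and `‖P e e‖ = ‖P e f‖ = ‖P f e‖ = ‖P f f‖`.
    rw [basisCount_singleton_of_finrank_eq_one hr he, basisCount_singleton_of_finrank_eq_one hr hf,
      ← h.norm_apply_self, ← h.norm_apply_self,
      norm_apply_eq_of_finrank_eq_one hC hr he hf (h.row_mem e),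
      ← norm_apply_eq_of_finrank_eq_one hC hr he hf (h.row_mem f), ← h.star_apply e f, norm_star]

/-- The diagonal entry of the projection at `e` is the fraction of bases containing `e`. -/
theorem re_mul_basisCount {C : Submodule ℍ[ℝ] (E → ℍ[ℝ])} {P : Matrix E E ℍ[ℝ]}
    (hC : QU.IsChainGroup C) (h : IsProjection C P) (e : E) :
    (P e e).re * basisCount C ∅ = basisCount C {e} := by
  induction hn : Module.finrank ℍ[ℝ] C generalizing C P e with
  | zero =>
    have h0 : ∀ c ∈ C, c e = 0 := by
      intro c hc
      rw [Submodule.finrank_eq_zero.1 hn] at hc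
      rw [(Submodule.mem_bot _).1 hc]
      rfl
    rw [h.re_eq_zero h0, basisCount_eq_zero h0 (Finset.mem_singleton_self e)]
    simp
  | succ n ih =>
    have hcomm := re_mul_basisCount_comm hC h fun e he f =>
      ih (vanishingAt_isChainGroup hC e) (h.downdate he) f (by
        have := finrank_vanishingAt (h.exists_ne_zero he)
        omega)
    -- Summing the proportionality over `f` puts a factor equal to the rank `n + 1` on both sides,
    -- which cancels.
    have hsum := Finset.sum_congr rfl fun f (_ : f ∈ Finset.univ) => hcomm e f
    rw [← Finset.mul_sum, ← Finset.sum_mul, h.sum_re, ← Nat.cast_sum, sum_basisCount, hn] at hsum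
    push_cast at hsum
    have : (n + 1 : ℝ) ≠ 0 := by positivity
    apply mul_left_cancel₀ this
    linear_combination hsum

end Projection

/-! ### `δ` and Schur complements. -/

section Schur

/-- The complex matrix obtained by replacing quaternions by `2 × 2` blocks. -/
noncomputable def unwrap {X Y : Type*} (D : Matrix X Y ℍ[ℝ]) :
    Matrix (X × Fin 2) (Y × Fin 2) ℂ :=
  Matrix.comp X Y (Fin 2) (Fin 2) ℂ (D.map quaternionPhi)

theorem unwrap_apply {X Y : Type*} (D : Matrix X Y ℍ[ℝ]) (i : X × Fin 2) (j : Y × Fin 2) :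
    unwrap D i j = quaternionPhi (D i.1 j.1) i.2 j.2 := rfl

theorem unwrap_mul {X Y Z : Type*} [Fintype Y] (A : Matrix X Y ℍ[ℝ]) (B : Matrix Y Z ℍ[ℝ]) :
    unwrap (A * B) = unwrap A * unwrap B := by
  ext i j
  simp [unwrap_apply, Matrix.mul_apply, Fintype.sum_prod_type, map_sum, map_mul, Matrix.sum_apply]

theorem unwrap_sub {X Y : Type*} (A B : Matrix X Y ℍ[ℝ]) :
    unwrap (A - B) = unwrap A - unwrap B := by
  ext i j
  simp [unwrap_apply]

theorem unwrap_one {X : Type*} [DecidableEq X] :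
    unwrap (1 : Matrix X X ℍ[ℝ]) = 1 := by
  ext ⟨i, a⟩ ⟨j, b⟩
  by_cases h : i = j
  · subst h
    simp [unwrap_apply, Matrix.one_apply]
  · simp [unwrap_apply, h]

theorem quaternionDelta_eq {X : Type*} [Fintype X] [DecidableEq X] (D : Matrix X X ℍ[ℝ]) :
    quaternionDelta D = Real.sqrt ‖(unwrap D).det‖ := rfl

theorem quaternionDelta_reindex {X Y : Type*} [Fintype X] [DecidableEq X] [Fintype Y]
    [DecidableEq Y] (σ : Y ≃ X) (D : Matrix X X ℍ[ℝ]) :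
    quaternionDelta (D.submatrix σ σ) = quaternionDelta D := by
  rw [quaternionDelta_eq, quaternionDelta_eq,
    ← Matrix.det_submatrix_equiv_self (σ.prodCongr (Equiv.refl (Fin 2)))]
  rfl

theorem quaternionDelta_of_isEmpty {X : Type*} [Fintype X] [DecidableEq X] [IsEmpty X]
    (D : Matrix X X ℍ[ℝ]) : quaternionDelta D = 1 := by
  rw [quaternionDelta_eq, Matrix.det_isEmpty, norm_one, Real.sqrt_one]

theorem quaternionDelta_of_row_eq_zero {X : Type*} [Fintype X] [DecidableEq X]
    (D : Matrix X X ℍ[ℝ]) (i : X) (hi : ∀ j, D i j = 0) : quaternionDelta D = 0 := by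
  rw [quaternionDelta_eq, Matrix.det_eq_zero_of_row_eq_zero (i, 0), norm_zero, Real.sqrt_zero]
  intro j
  rw [unwrap_apply, hi, map_zero]
  rfl

/-- `φ(p)` is the scalar matrix `p`, of determinant `p²`; the square root in `δ` undoes the doubling
of size. -/
theorem quaternionDelta_unique (p : ℝ) :
    quaternionDelta (Matrix.of fun _ _ : Unit => (p : ℍ[ℝ])) = |p| := by
  rw [quaternionDelta_eq,
    ← Matrix.det_submatrix_equiv_self (Equiv.punitProd (Fin 2)).symm, Matrix.det_fin_two]
  simp only [Matrix.submatrix_apply, unwrap_apply, quaternionPhi]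
  rw [← Real.sqrt_sq_eq_abs]
  congr 1
  have h1 : (⟨p, 0⟩ : ℂ) = (p : ℂ) := rfl
  have h2 : (⟨0, 0⟩ : ℂ) = 0 := rfl
  simp [h1, h2, ← Complex.ofReal_mul, sq]

/-- The Schur complement formula for `δ`. -/
theorem quaternionDelta_fromBlocks {X Y : Type*} [Fintype X] [DecidableEq X] [Fintype Y]
    [DecidableEq Y] (A A' : Matrix X X ℍ[ℝ]) (B : Matrix X Y ℍ[ℝ]) (C : Matrix Y X ℍ[ℝ])
    (D : Matrix Y Y ℍ[ℝ]) (hA : A * A' = 1) :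
    quaternionDelta (Matrix.fromBlocks A B C D) =
      quaternionDelta A * quaternionDelta (D - C * A' * B) := by
  have h1 : unwrap A * unwrap A' = 1 := by rw [← unwrap_mul, hA, unwrap_one]
  let _ : Invertible (unwrap A) := ⟨unwrap A', mul_eq_one_comm.1 h1, h1⟩
  have h2 : ⅟(unwrap A) = unwrap A' := invOf_eq_right_inv h1
  have h3 : (unwrap (Matrix.fromBlocks A B C D)).submatrix (Equiv.sumProdDistrib X Y (Fin 2)).symm
      (Equiv.sumProdDistrib X Y (Fin 2)).symm =
        Matrix.fromBlocks (unwrap A) (unwrap B) (unwrap C) (unwrap D) := by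
    ext (i | i) (j | j) <;> rfl
  rw [quaternionDelta_eq, quaternionDelta_eq, quaternionDelta_eq,
    ← Matrix.det_submatrix_equiv_self (Equiv.sumProdDistrib X Y (Fin 2)).symm, h3,
    Matrix.det_fromBlocks₁₁, h2, unwrap_sub, unwrap_mul, unwrap_mul, norm_mul,
    Real.sqrt_mul (norm_nonneg _)]

end Schur

/-! ### The induction on `F`. -/

section Main

variable {E : Type*} [Fintype E] [DecidableEq E]

/-- With `{e}` listed first, the pivot block is the 1×1 matrix `P e e`, and its Schur complement is
the restriction of the downdate to `F`. -/
theorem quaternionDelta_submatrix_insert {C : Submodule ℍ[ℝ] (E → ℍ[ℝ])} {P : Matrix E E ℍ[ℝ]}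
    (h : IsProjection C P) {e : E} (he : (P e e).re ≠ 0) {F : Finset E} (heF : e ∉ F) :
    quaternionDelta (P.submatrix (fun x : {x // x ∈ insert e F} => (x : E))
        (fun x : {x // x ∈ insert e F} => (x : E))) =
      (P e e).re * quaternionDelta ((downdate P e).submatrix (fun x : {x // x ∈ F} => (x : E))
        (fun x : {x // x ∈ F} => (x : E))) := by
  let σ : Unit ⊕ {x // x ∈ F} ≃ {x // x ∈ insert e F} :=
    ((Equiv.sumComm _ _).trans (Equiv.optionEquivSumPUnit _).symm).trans
      (Finset.subtypeInsertEquivOption heF).symm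
  rw [← quaternionDelta_reindex σ]
  set A : Matrix Unit Unit ℍ[ℝ] := Matrix.of fun _ _ => (((P e e).re : ℝ) : ℍ[ℝ]) with hA
  set A' : Matrix Unit Unit ℍ[ℝ] := Matrix.of fun _ _ => ((((P e e).re)⁻¹ : ℝ) : ℍ[ℝ]) with hA'
  have hblocks : (P.submatrix (fun x : {x // x ∈ insert e F} => (x : E))
      (fun x : {x // x ∈ insert e F} => (x : E))).submatrix σ σ =
      Matrix.fromBlocks A (Matrix.of fun _ (x : {x // x ∈ F}) => P e x)
        (Matrix.of fun (x : {x // x ∈ F}) _ => P x e)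
        (P.submatrix (fun x : {x // x ∈ F} => (x : E)) (fun x => (x : E))) := by
    ext1 (i | i) (j | j)
    · exact h.apply_self e
    all_goals rfl
  have hAA : A * A' = 1 := by
    ext1 i j
    have he' : (((P e e).re : ℝ) : ℍ[ℝ]) ≠ 0 := by
      rw [← h.apply_self]
      exact fun h0 => he (by rw [h0]; rfl)
    simp [hA, hA', Matrix.mul_apply, mul_inv_cancel₀ he']
  rw [hblocks, quaternionDelta_fromBlocks A A' _ _ _ hAA, quaternionDelta_unique,
    ← h.norm_apply_self, abs_norm]
  congr 2
  ext1 x y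
  simp [hA', Matrix.mul_apply, downdate_apply]

theorem quaternionDelta_submatrix {C : Submodule ℍ[ℝ] (E → ℍ[ℝ])} {P : Matrix E E ℍ[ℝ]}
    (hC : QU.IsChainGroup C) (h : IsProjection C P) (F : Finset E) :
    quaternionDelta (P.submatrix (fun x : {x // x ∈ F} => (x : E))
        (fun x : {x // x ∈ F} => (x : E))) * basisCount C ∅ = basisCount C F := by
  induction F using Finset.induction_on generalizing C P with
  | empty => rw [quaternionDelta_of_isEmpty, one_mul]
  | insert e F heF ih =>
    by_cases he : (P e e).re = 0
    -- If `e` is a loop, no basis contains it, and column `e` of `P` vanishes, hence by symmetry row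
    -- `e`.
    · rw [basisCount_eq_zero (h.apply_eq_zero he) (Finset.mem_insert_self e F),
        quaternionDelta_of_row_eq_zero _ ⟨e, Finset.mem_insert_self e F⟩, zero_mul, Nat.cast_zero]
      intro x
      rw [Matrix.submatrix_apply, ← h.star_apply, h.apply_eq_zero he _ (h.row_mem _), star_zero]
    · have hne := h.exists_ne_zero he
      -- The factor `P e e * N(∅)` becomes `N({e})`, the number of bases of the contraction, as the
      -- induction hypothesis requires.
      rw [quaternionDelta_submatrix_insert h he heF, mul_right_comm, re_mul_basisCount hC h,
        ← basisCount_vanishingAt hne heF, ← ih (vanishingAt_isChainGroup hC e) (h.downdate he),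
        basisCount_vanishingAt hne (Finset.notMem_empty e), insert_empty_eq, mul_comm]

end Main

/-- For a `QU`-chain group `C` on `E` and `F ⊆ E`, `δ(P_C[F, F])` is the fraction of the bases of
`M(C)` that contain `F`. -/
theorem mainTheorem7 {E : Type*} [Fintype E] [DecidableEq E]
    (C : Submodule ℍ[ℝ] (E → ℍ[ℝ])) (hC : QU.IsChainGroup C) (F : Finset E) :
    quaternionDelta ((projectionMatrix C).submatrix
        (fun e : {x // x ∈ F} => (e : E)) (fun e : {x // x ∈ F} => (e : E))) =
      ({B : Set E | hC.matroid.IsBase B ∧ (F : Set E) ⊆ B}.ncard : ℝ) /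
        ({B : Set E | hC.matroid.IsBase B}.ncard : ℝ) := by
  have h := quaternionDelta_submatrix hC (isProjection_projectionMatrix C) F
  have h0 := ncard_isBase hC ∅
  simp only [Finset.coe_empty, Set.empty_subset, and_true] at h0
  have hpos : (basisCount C ∅ : ℝ) ≠ 0 := Nat.cast_ne_zero.2 (basisCount_empty_pos C).ne'
  rw [ncard_isBase, h0, eq_div_iff hpos, h]
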